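/- Let $B_1=\{z\in\mathbb{C}:|z|<1\}$. Let $h\in C^1(\overline{B_1})$ be complex-valued, and suppose that $h$ is holomorphic and nonconstant on $B_1$; for $|z|=1$ let $h'(z)$ denote the complex derivative of $h$ relative to $\overline{B_1}$ (equivalently, the continuous extension of $h'|_{B_1}$). Let $\varrho:[0,+\infty)\to[0,1)$ be continuous on $[0,+\infty)$ and smooth on $(0,+\infty)$ (in particular, any $\varrho$ smooth on $[0,+\infty)$ is allowed), with $\varrho'(x)>0$ for all $x>0$, $\varrho(0)=0$ and $\lim_{x\to+\infty}\varrho(x)=1$. On $\mathbb{R}\times(0,+\infty)$ consider the Hamilton function \[ \mathcal{Z}(\chi_1,J_1)=\operatorname{Re}\left[h\left(\varrho(J_1)e^{i\chi_1}\right)\right] \] and the Hamiltonian equations \[ \chi_1'(t)=\frac{\partial\mathcal{Z}}{\partial J_1}(\chi_1(t),J_1(t)),\qquad J_1'(t)=-\frac{\partial\mathcal{Z}}{\partial\chi_1}(\chi_1(t),J_1(t)). \] Then for Lebesgue-almost all initial conditions $(\chi_1(0),J_1(0))\in\mathbb{R}\times(0,+\infty)$ the trajectory with this initial condition exists for all $t\ge0$,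 and it satisfies \[ \lim_{t\to+\infty}\chi_1(t)=\chi_1(\infty)\in\mathbb{R},\qquad \lim_{t\to+\infty}J_1(t)=+\infty, \] and \[ \lim_{t\to+\infty}J_1'(t)=\operatorname{Im}\left[e^{i\chi_1(\infty)}\,h'\left(e^{i\chi_1(\infty)}\right)\right]>0. \] -/

import Mathlib

open Set Filter Topology MeasureTheory
open scoped ContDiff

/-- The Hamilton function `Z(χ, J) = Re h(ϱ(J) e^{iχ})` in the angle `χ` and the action `J`. -/
noncomputable def diskHamiltonian (h : ℂ → ℂ) (ϱ : ℝ → ℝ) (χ J : ℝ) : ℝ :=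
  (h ((ϱ J : ℂ) * Complex.exp (Complex.I * (χ : ℂ)))).re

/-- `t ↦ (χ t, J t)`, `t ∈ [0, ∞)`, is a trajectory in the phase space `ℝ × (0, ∞)` of the
Hamiltonian system `χ' = ∂H/∂J`, `J' = -∂H/∂χ` (one-sided derivatives at the initial time `0`). -/
structure IsHamiltonianTrajectory (H : ℝ → ℝ → ℝ) (χ J : ℝ → ℝ) : Prop where
  pos : ∀ t : ℝ, 0 ≤ t → 0 < J t
  angle_eq : ∀ t : ℝ, 0 ≤ t →
    HasDerivWithinAt χ (deriv (fun j : ℝ => H (χ t) j) (J t)) (Ici 0) t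
  action_eq : ∀ t : ℝ, 0 ≤ t →
    HasDerivWithinAt J (-deriv (fun x : ℝ => H x (J t)) (χ t)) (Ici 0) t

/-! Write `z = ϱ(J) e^{iχ}`. Along the flow `Re h(z)` is conserved, while `Im h(z)` grows at rate `ϱ
ϱ' |h'(z)|²` (`hasDerivWithinAt_comp`) and stays bounded, so it converges. Fix a level `Re h = c`.
If `c ≠ Re h(0)`, the action stays above some `δ > 0`, and `|J'| ≤ sup |h'|`; so the trajectory is
global (`exists_trajectory`).

If the level contains no critical point of `h`, then `Im h` has speed bounded below wherever `J` is
bounded; convergence of `Im h` therefore forces `J → ∞` (`tendsto_action`). Now `Re h(e^{iχ}) → c`,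
and if `c` is a regular value of the boundary function, then `χ` converges to some `θ`
(`exists_tendsto_of_tendsto_regular_value`). The limit of `J'` is minus the boundary derivative at
`θ`, hence nonzero, and it is nonnegative because `J → ∞`.

The excluded levels form a null set, by countability of the critical points and one-dimensional
Sard. Away from critical points `(χ, J) ↦ h(z)` is a local diffeomorphism, so almost every phase
point lies on a good level (`volume_setOf_exceptional`). -/

/-! ### Tools: boundary derivatives, null sets, gluing of solutions, convergence of curves -/

/-- A function that is `C¹` in the real sense on the closed disk and holomorphic in its interior
has a complex derivative relative to the closed disk at every point, which is continuous. -/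
theorem hasDerivWithinAt_closedBall {h : ℂ → ℂ}
    (hC1 : ContDiffOn ℝ 1 h (Metric.closedBall (0 : ℂ) 1))
    (hhol : DifferentiableOn ℂ h (Metric.ball (0 : ℂ) 1)) :
    (∀ z ∈ Metric.closedBall (0 : ℂ) 1, HasDerivWithinAt h
      (derivWithin h (Metric.closedBall (0 : ℂ) 1) z) (Metric.closedBall (0 : ℂ) 1) z) ∧
    ContinuousOn (derivWithin h (Metric.closedBall (0 : ℂ) 1)) (Metric.closedBall (0 : ℂ) 1) := by
  set B := Metric.closedBall (0 : ℂ) 1 with hB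
  have hint : interior B = Metric.ball (0 : ℂ) 1 := interior_closedBall _ one_ne_zero
  have hcl : closure (Metric.ball (0 : ℂ) 1) = B := closure_ball _ one_ne_zero
  have hu : UniqueDiffOn ℝ B :=
    uniqueDiffOn_convex (convex_closedBall _ _) (by rw [hint]; simp)
  have huC : UniqueDiffOn ℂ B := fun z hz => (hu z hz).mono_field
  have hD : ContinuousOn (fderivWithin ℝ h B) B := hC1.continuousOn_fderivWithin hu le_rfl
  -- Complex linearity of the real derivative holds in the open disk and passes to the boundary by
  -- continuity and density.
  have hcomm : ∀ v : ℂ, ∀ z ∈ B, fderivWithin ℝ h B z v = v * fderivWithin ℝ h B z 1 := by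
    intro v
    have heq : EqOn (fun z => fderivWithin ℝ h B z v) (fun z => v * fderivWithin ℝ h B z 1)
        (Metric.ball (0 : ℂ) 1) := by
      intro z hz
      have hz' : B ∈ 𝓝 z := mem_of_superset (Metric.isOpen_ball.mem_nhds hz)
        Metric.ball_subset_closedBall
      have hd : HasDerivAt h (deriv h z) z :=
        (hhol.differentiableAt (Metric.isOpen_ball.mem_nhds hz)).hasDerivAt
      simp only [fderivWithin_of_mem_nhds hz', (hd.hasFDerivAt.restrictScalars ℝ).fderiv]
      simp
    have := heq.of_subset_closure (t := B) ?_ ?_ Metric.ball_subset_closedBall hcl.ge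
    · exact fun z hz => this hz
    · exact hD.clm_apply continuousOn_const
    · exact continuousOn_const.mul (hD.clm_apply continuousOn_const)
  have hder : ∀ z ∈ B, HasDerivWithinAt h (fderivWithin ℝ h B z 1) B z := by
    intro z hz
    have h1 : HasFDerivWithinAt h (fderivWithin ℝ h B z) B z :=
      (hC1.differentiableOn one_ne_zero z hz).hasFDerivWithinAt
    rw [hasDerivWithinAt_iff_hasFDerivWithinAt]
    refine HasFDerivWithinAt.of_restrictScalars ℝ h1 ?_
    ext v
    simpa using (hcomm v z hz).symm
  have heq : ∀ z ∈ B, derivWithin h B z = fderivWithin ℝ h B z 1 := fun z hz =>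
    (hder z hz).derivWithin (huC z hz)
  refine ⟨fun z hz => by rw [heq z hz]; exact hder z hz, ?_⟩
  exact (hD.clm_apply continuousOn_const).congr heq

/-- A set whose image under a local diffeomorphism is null is null. -/
theorem measure_eq_zero_of_image_of_hasStrictFDerivAt {E : Type*} [NormedAddCommGroup E]
    [NormedSpace ℝ E] [FiniteDimensional ℝ E] [MeasurableSpace E] [BorelSpace E]
    (μ : Measure E) [μ.IsAddHaarMeasure] {f : E → E} {s : Set E}
    (hf : ∀ x ∈ s, ∃ f' : E →L[ℝ] E, HasStrictFDerivAt f f' x ∧ Function.Injective f')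
    (hs : μ (f '' s) = 0) : μ s = 0 := by
  have : CompleteSpace E := FiniteDimensional.complete ℝ E
  have hequiv : ∀ x ∈ s, ∃ f' : E ≃L[ℝ] E, HasStrictFDerivAt f (f' : E →L[ℝ] E) x := by
    intro x hx
    obtain ⟨f', h1, h2⟩ := hf x hx
    refine ⟨(LinearEquiv.ofInjectiveEndo (f' : E →ₗ[ℝ] E) h2).toContinuousLinearEquiv, ?_⟩
    convert h1 using 1
    ext v
    simp
  refine measure_null_of_locally_null s fun x hx => ?_
  obtain ⟨f', h'⟩ := hequiv x hx
  set e := h'.toOpenPartialHomeomorph f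
  have hxe : x ∈ e.source := h'.mem_toOpenPartialHomeomorph_source
  have hef : ∀ y, e y = f y := fun y => rfl
  refine ⟨s ∩ e.source, inter_mem_nhdsWithin s (e.open_source.mem_nhds hxe), ?_⟩
  have himg : e.symm '' (f '' (s ∩ e.source)) = s ∩ e.source := by
    rw [image_image]
    ext y
    constructor
    · rintro ⟨w, hw, rfl⟩
      simpa only [← hef, e.left_inv hw.2] using hw
    · intro hy
      exact ⟨y, hy, e.left_inv hy.2⟩
  rw [← himg]
  refine addHaar_image_eq_zero_of_differentiableOn_of_addHaar_eq_zero μ ?_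
    (measure_mono_null (image_mono inter_subset_left) hs)
  rintro _ ⟨y, hy, rfl⟩
  -- The inverse is differentiable at `f y` because the derivative of `f` is invertible at `y`
  -- itself, not only at the base point `x`.
  obtain ⟨g', hg⟩ := hequiv y hy.1
  have hft : f y ∈ e.target := e.map_source hy.2
  have : HasFDerivAt e.symm (g'.symm : E →L[ℝ] E) (f y) := by
    refine e.hasFDerivAt_symm hft ?_
    rw [← hef, e.left_inv hy.2]
    exact hg.hasFDerivAt
  exact this.differentiableAt.differentiableWithinAt

/-- The critical points of a nonconstant holomorphic function on the disk are countable. -/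
theorem countable_setOf_deriv_eq_zero {h : ℂ → ℂ}
    (hhol : DifferentiableOn ℂ h (Metric.ball (0 : ℂ) 1))
    (hnonconst : ¬ ∃ c : ℂ, ∀ z ∈ Metric.ball (0 : ℂ) 1, h z = c) :
    {z ∈ Metric.ball (0 : ℂ) 1 | deriv h z = 0}.Countable := by
  have han : AnalyticOnNhd ℂ (deriv h) (Metric.ball (0 : ℂ) 1) :=
    (hhol.deriv Metric.isOpen_ball).analyticOnNhd Metric.isOpen_ball
  have hpre : IsPreconnected (Metric.ball (0 : ℂ) 1) := (convex_ball _ _).isPreconnected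
  -- A discrete Lindelöf set is countable; an accumulation of critical points at one of them would
  -- make `h'` vanish identically.
  refine IsLindelof.countable (HereditarilyLindelofSpace.isLindelof _) ?_
  rw [discreteTopology_subtype_iff]
  rintro z ⟨hz, -⟩
  rcases (han z hz).eventually_eq_zero_or_eventually_ne_zero with h0 | h0
  · exact absurd (Metric.isOpen_ball.exists_is_const_of_deriv_eq_zero hpre hhol
      (han.eqOn_zero_of_preconnected_of_eventuallyEq_zero hpre hz h0)) hnonconst
  · rw [inf_principal_eq_bot]
    filter_upwards [h0] with w hw using fun hw' => hw hw'.2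

/-- Solutions of a locally Lipschitz autonomous equation on all compact intervals `[0, n]` that
stay in `U` assemble to a solution on `[0, ∞)`. -/
theorem exists_solution_Ici_of_forall_nat {E : Type*} [NormedAddCommGroup E] [NormedSpace ℝ E]
    {V : E → E} {U : Set E} {x₀ : E} (hV : LocallyLipschitzOn U V)
    (hsol : ∀ n : ℕ, ∃ γ : ℝ → E, γ 0 = x₀ ∧ ∀ t ∈ Icc (0 : ℝ) n,
      γ t ∈ U ∧ HasDerivWithinAt γ (V (γ t)) (Icc 0 (n : ℝ)) t) :
    ∃ γ : ℝ → E, γ 0 = x₀ ∧ ∀ t, 0 ≤ t → γ t ∈ U ∧ HasDerivWithinAt γ (V (γ t)) (Ici 0) t := by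
  choose γ h0 hγ using hsol
  have hcont : ∀ n, ContinuousOn (γ n) (Icc (0 : ℝ) n) := fun n t ht =>
    (hγ n t ht).2.continuousWithinAt
  have huniq : ∀ m n : ℕ, m ≤ n → EqOn (γ m) (γ n) (Icc (0 : ℝ) m) := by
    intro m n hmn
    have hsub : Icc (0 : ℝ) m ⊆ Icc (0 : ℝ) n := Icc_subset_Icc_right (by exact_mod_cast hmn)
    -- A compact set containing both curves supplies the single Lipschitz constant that uniqueness
    -- needs.
    set K := γ m '' Icc (0 : ℝ) m ∪ γ n '' Icc (0 : ℝ) m with hK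
    have hKc : IsCompact K := (isCompact_Icc.image_of_continuousOn (hcont m)).union
      (isCompact_Icc.image_of_continuousOn ((hcont n).mono hsub))
    have hKU : K ⊆ U := by
      rintro _ (⟨t, ht, rfl⟩ | ⟨t, ht, rfl⟩)
      · exact (hγ m t ht).1
      · exact (hγ n t (hsub ht)).1
    obtain ⟨C, hC⟩ := (hV.mono hKU).exists_lipschitzOnWith_of_compact hKc
    have key : ∀ k : ℕ, m ≤ k → ∀ t ∈ Ico (0 : ℝ) m,
        HasDerivWithinAt (γ k) (V (γ k t)) (Ici t) t := by
      intro k hk t ht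
      have htk : t < k := ht.2.trans_le (by exact_mod_cast hk)
      exact (hγ k t ⟨ht.1, htk.le⟩).2.mono_of_mem_nhdsWithin
        (mem_of_superset (Icc_mem_nhdsGE htk) (Icc_subset_Icc_left ht.1))
    exact ODE_solution_unique_of_mem_Icc_right (v := fun _ => V) (s := fun _ => K)
      (fun _ _ => hC) (hcont m) (key m le_rfl)
      (fun t ht => Or.inl ⟨t, Ico_subset_Icc_self ht, rfl⟩)
      ((hcont n).mono hsub) (key n hmn)
      (fun t ht => Or.inr ⟨t, Ico_subset_Icc_self ht, rfl⟩) (by rw [h0, h0])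
  -- The `+ 1` makes the index exceed `t` strictly, so one fixed solution describes the glued curve
  -- on both sides of `t`.
  refine ⟨fun t => γ (⌈t⌉₊ + 1) t, h0 _, fun t ht => ?_⟩
  set n := ⌈t⌉₊ + 1 with hn
  have htn : t < n := by
    rw [hn]; push_cast; exact (Nat.le_ceil t).trans_lt (lt_add_one _)
  have heq : ∀ s ∈ Ico (0 : ℝ) n, γ (⌈s⌉₊ + 1) s = γ n s := by
    intro s hs
    have hs1 : s < ((⌈s⌉₊ + 1 : ℕ) : ℝ) := by
      push_cast; exact (Nat.le_ceil s).trans_lt (lt_add_one _)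
    rcases le_total (⌈s⌉₊ + 1) n with h | h
    · exact huniq _ _ h ⟨hs.1, hs1.le⟩
    · exact (huniq _ _ h ⟨hs.1, hs.2.le⟩).symm
  have hmem : Ico (0 : ℝ) n ∈ 𝓝[Ici 0] t := by
    rw [← Ici_inter_Iio]
    exact inter_mem_nhdsWithin _ (Iio_mem_nhds htn)
  refine ⟨(hγ n t ⟨ht, htn.le⟩).1, ?_⟩
  have h1 : HasDerivWithinAt (γ n) (V (γ n t)) (Ici 0) t :=
    (hγ n t ⟨ht, htn.le⟩).2.mono_of_mem_nhdsWithin (mem_of_superset hmem Ico_subset_Icc_self)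
  exact h1.congr_of_eventuallyEq (by filter_upwards [hmem] with s hs using heq s hs) rfl

/-- A curve along which a function `g` with period `T` tends to a regular value `c` converges. -/
theorem exists_tendsto_of_tendsto_regular_value {g g' : ℝ → ℝ} {T c : ℝ} (hT : 0 < T)
    (hper : Function.Periodic g T) (hg : ∀ θ, HasDerivAt g (g' θ) θ)
    (hreg : ∀ θ, g θ = c → g' θ ≠ 0) {χ : ℝ → ℝ} (hχ : ContinuousOn χ (Ici 0))
    (hlim : Tendsto (fun t => g (χ t)) atTop (𝓝 c)) : ∃ l, Tendsto χ atTop (𝓝 l) := by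
  have hne : ∀ a b, a < b → ∃ y ∈ Ioo a b, g y ≠ c := by
    intro a b hab
    by_contra! hcon
    obtain ⟨m, hm⟩ := exists_between hab
    refine hreg m (hcon m hm) ((hg m).unique ?_)
    refine (hasDerivAt_const m c).congr_of_eventuallyEq ?_
    filter_upwards [Ioo_mem_nhds hm.1 hm.2] with y hy using hcon y hy
  -- A point `y` with `g y ≠ c` is a barrier: eventually `χ` cannot cross it or any of its
  -- translates by the period.
  have hmiss : ∀ y, g y ≠ c → ∃ S : ℝ, 0 ≤ S ∧ ∀ t, S ≤ t → g (χ t) ≠ g y := by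
    intro y hy
    obtain ⟨S, hS⟩ := eventually_atTop.1 (hlim.eventually_ne hy.symm)
    exact ⟨max S 0, le_max_right _ _, fun t ht => hS t ((le_max_left _ _).trans ht)⟩
  have hivt : ∀ S : ℝ, 0 ≤ S → ∀ s t, S ≤ s → S ≤ t → ∀ y ∈ Icc (χ s) (χ t),
      ∃ r, S ≤ r ∧ χ r = y := by
    intro S hS s t hs ht y hy
    have := intermediate_value_uIcc
      (hχ.mono (fun r hr => (hS.trans (le_inf hs ht)).trans hr.1) : ContinuousOn χ (uIcc s t))
    obtain ⟨r, hr, hry⟩ := this (Icc_subset_uIcc hy)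
    exact ⟨r, (le_inf hs ht).trans hr.1, hry⟩
  obtain ⟨y, -, hy⟩ := hne 0 1 one_pos
  obtain ⟨S, hS, hSy⟩ := hmiss y hy
  have hno : ∀ s t, S ≤ s → S ≤ t → χ t < χ s + T := by
    intro s t hs ht
    by_contra! hcon
    obtain ⟨k, hk, -⟩ := existsUnique_add_zsmul_mem_Ico hT y (χ s)
    obtain ⟨r, hr, hry⟩ := hivt S hS s t hs ht _ ⟨hk.1, hk.2.le.trans hcon⟩
    exact hSy r hr (by rw [hry]; exact hper.zsmul k y)
  refine tendsto_of_no_upcrossings dense_univ ?_ ?_ ?_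
  -- Endless oscillation across `(a, b)` would keep crossing a barrier inside it.
  · rintro a - b - hab ⟨ha, hb⟩
    obtain ⟨w, hw, hwc⟩ := hne a b hab
    obtain ⟨R, hR, hRw⟩ := hmiss w hwc
    obtain ⟨s, hs, hsa⟩ := frequently_atTop.1 ha R
    obtain ⟨t, ht, htb⟩ := frequently_atTop.1 hb R
    obtain ⟨r, hr, hrw⟩ := hivt R hR s t hs ht w ⟨(hsa.trans hw.1).le, (hw.2.trans htb).le⟩
    exact hRw r hr (by rw [hrw])
  · exact ⟨χ S + T, eventually_map.2 ((eventually_ge_atTop S).mono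
      fun t ht => (hno S t le_rfl ht).le)⟩
  · exact ⟨χ S - T, eventually_map.2 ((eventually_ge_atTop S).mono
      fun t ht => by linarith [hno t S ht le_rfl])⟩

/-! ### The disk system: vector field, conservation law and bounds -/

/-- The standing assumptions on the holomorphic function `h` and on the radius `ϱ`. -/
structure IsDiskSystem (h : ℂ → ℂ) (ϱ : ℝ → ℝ) : Prop where
  contDiffOn : ContDiffOn ℝ 1 h (Metric.closedBall (0 : ℂ) 1)
  holomorphic : DifferentiableOn ℂ h (Metric.ball (0 : ℂ) 1)
  mapsTo : MapsTo ϱ (Ici 0) (Ico 0 1)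
  continuousOn : ContinuousOn ϱ (Ici 0)
  smooth : ContDiffOn ℝ ∞ ϱ (Ioi 0)
  deriv_pos : ∀ x : ℝ, 0 < x → 0 < deriv ϱ x
  zero : ϱ 0 = 0
  tendsto_one : Tendsto ϱ atTop (𝓝 1)

/-- The point of the disk with angle `χ` and action `J`. -/
noncomputable def diskPoint (ϱ : ℝ → ℝ) (χ J : ℝ) : ℂ :=
  (ϱ J : ℂ) * Complex.exp (Complex.I * (χ : ℂ))

/-- The complex derivative relative to the closed unit disk. -/
noncomputable def diskDeriv (h : ℂ → ℂ) (z : ℂ) : ℂ :=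
  derivWithin h (Metric.closedBall (0 : ℂ) 1) z

/-- The Hamiltonian vector field of `diskHamiltonian h ϱ`. -/
noncomputable def diskField (h : ℂ → ℂ) (ϱ : ℝ → ℝ) (p : ℝ × ℝ) : ℝ × ℝ :=
  (deriv ϱ p.2 * (Complex.exp (Complex.I * (p.1 : ℂ)) * diskDeriv h (diskPoint ϱ p.1 p.2)).re,
    (diskPoint ϱ p.1 p.2 * diskDeriv h (diskPoint ϱ p.1 p.2)).im)

theorem norm_exp_I_mul (x : ℝ) : ‖Complex.exp (Complex.I * (x : ℂ))‖ = 1 := by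
  rw [mul_comm]; exact Complex.norm_exp_ofReal_mul_I x

theorem exp_I_mul_mem_closedBall (x : ℝ) :
    Complex.exp (Complex.I * (x : ℂ)) ∈ Metric.closedBall (0 : ℂ) 1 := by
  simp

theorem hasDerivAt_exp_I_mul (x : ℝ) :
    HasDerivAt (fun x : ℝ => Complex.exp (Complex.I * (x : ℂ)))
      (Complex.I * Complex.exp (Complex.I * (x : ℂ))) x := by
  have h1 : HasDerivAt (fun x : ℝ => Complex.I * (x : ℂ)) (Complex.I * 1) x :=
    (Complex.ofRealCLM.hasDerivAt (x := x)).const_mul Complex.I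
  simpa [mul_comm] using h1.cexp

theorem HasDerivWithinAt.re' {f : ℝ → ℂ} {f' : ℂ} {s : Set ℝ} {t : ℝ}
    (hf : HasDerivWithinAt f f' s t) : HasDerivWithinAt (fun t => (f t).re) f'.re s t :=
  Complex.reCLM.hasFDerivAt.comp_hasDerivWithinAt t hf

theorem HasDerivWithinAt.im' {f : ℝ → ℂ} {f' : ℂ} {s : Set ℝ} {t : ℝ}
    (hf : HasDerivWithinAt f f' s t) : HasDerivWithinAt (fun t => (f t).im) f'.im s t :=
  Complex.imCLM.hasFDerivAt.comp_hasDerivWithinAt t hf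

/-- Serves three kinds of curve: coordinate lines for the partial derivatives of the Hamiltonian,
trajectories, and straight lines when testing injectivity of the differential. -/
theorem hasDerivWithinAt_diskPoint {ϱ χ J : ℝ → ℝ} {s : Set ℝ} {t ϱ' χ' J' : ℝ}
    (hϱ : HasDerivAt ϱ ϱ' (J t)) (hχ : HasDerivWithinAt χ χ' s t)
    (hJ : HasDerivWithinAt J J' s t) :
    HasDerivWithinAt (fun t => diskPoint ϱ (χ t) (J t))
      (((ϱ' * J' : ℝ) + (ϱ (J t) : ℂ) * Complex.I * (χ' : ℂ)) *
        Complex.exp (Complex.I * (χ t : ℂ))) s t := by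
  have h1 : HasDerivWithinAt (fun t => (ϱ (J t) : ℂ)) ((ϱ' * J' : ℝ) : ℂ) s t :=
    (hϱ.comp_hasDerivWithinAt t hJ).ofReal_comp
  have h2 : HasDerivWithinAt (fun t => Complex.exp (Complex.I * (χ t : ℂ))) _ s t :=
    (hasDerivAt_exp_I_mul (χ t)).scomp_hasDerivWithinAt t hχ
  refine (h1.mul h2).congr_deriv ?_
  simp only [Complex.real_smul]
  ring

namespace IsDiskSystem

variable {h : ℂ → ℂ} {ϱ : ℝ → ℝ}

theorem hasDerivAt_radius (S : IsDiskSystem h ϱ) {x : ℝ} (hx : 0 < x) :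
    HasDerivAt ϱ (deriv ϱ x) x :=
  ((S.smooth.differentiableOn (by simp)).differentiableAt (Ioi_mem_nhds hx)).hasDerivAt

theorem strictMonoOn (S : IsDiskSystem h ϱ) : StrictMonoOn ϱ (Ici 0) :=
  strictMonoOn_of_deriv_pos (convex_Ici 0) S.continuousOn
    (by rw [interior_Ici]; exact S.deriv_pos)

theorem radius_pos (S : IsDiskSystem h ϱ) {x : ℝ} (hx : 0 < x) : 0 < ϱ x := by
  have := S.strictMonoOn self_mem_Ici hx.le hx
  rwa [S.zero] at this

theorem norm_diskPoint (S : IsDiskSystem h ϱ) (χ : ℝ) {J : ℝ} (hJ : 0 ≤ J) :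
    ‖diskPoint ϱ χ J‖ = ϱ J := by
  simp [diskPoint, abs_of_nonneg (S.mapsTo hJ).1]

theorem diskPoint_mem_ball (S : IsDiskSystem h ϱ) (χ : ℝ) {J : ℝ} (hJ : 0 ≤ J) :
    diskPoint ϱ χ J ∈ Metric.ball (0 : ℂ) 1 := by
  simpa [S.norm_diskPoint χ hJ] using (S.mapsTo hJ).2

theorem diskPoint_mem_closedBall (S : IsDiskSystem h ϱ) (χ : ℝ) {J : ℝ} (hJ : 0 ≤ J) :
    diskPoint ϱ χ J ∈ Metric.closedBall (0 : ℂ) 1 :=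
  Metric.ball_subset_closedBall (S.diskPoint_mem_ball χ hJ)

theorem hasDerivWithinAt (S : IsDiskSystem h ϱ) {z : ℂ} (hz : z ∈ Metric.closedBall (0 : ℂ) 1) :
    HasDerivWithinAt h (diskDeriv h z) (Metric.closedBall (0 : ℂ) 1) z :=
  (hasDerivWithinAt_closedBall S.contDiffOn S.holomorphic).1 z hz

theorem continuousOn_diskDeriv (S : IsDiskSystem h ϱ) :
    ContinuousOn (diskDeriv h) (Metric.closedBall (0 : ℂ) 1) :=
  (hasDerivWithinAt_closedBall S.contDiffOn S.holomorphic).2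

theorem hasDerivAt (S : IsDiskSystem h ϱ) {z : ℂ} (hz : z ∈ Metric.ball (0 : ℂ) 1) :
    HasDerivAt h (diskDeriv h z) z :=
  (S.hasDerivWithinAt (Metric.ball_subset_closedBall hz)).hasDerivAt
    (mem_of_superset (Metric.isOpen_ball.mem_nhds hz) Metric.ball_subset_closedBall)

theorem exists_norm_diskDeriv_le (S : IsDiskSystem h ϱ) :
    ∃ M : ℝ, 0 < M ∧ ∀ z ∈ Metric.closedBall (0 : ℂ) 1, ‖diskDeriv h z‖ ≤ M := by
  obtain ⟨M, hM⟩ := (isCompact_closedBall (0 : ℂ) 1).exists_bound_of_continuousOn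
    S.continuousOn_diskDeriv
  exact ⟨max M 1, by positivity, fun z hz => (hM z hz).trans (le_max_left _ _)⟩

theorem diskField_eq (S : IsDiskSystem h ϱ) (χ : ℝ) {J : ℝ} (hJ : 0 < J) :
    deriv (fun j => diskHamiltonian h ϱ χ j) J = (diskField h ϱ (χ, J)).1 ∧
      -deriv (fun x => diskHamiltonian h ϱ x J) χ = (diskField h ϱ (χ, J)).2 := by
  have hh := S.hasDerivAt (S.diskPoint_mem_ball χ hJ.le)
  have h1 := hasDerivWithinAt_diskPoint (χ := fun _ => χ) (J := id) (s := univ)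
    (S.hasDerivAt_radius hJ) (hasDerivWithinAt_const J univ χ) (hasDerivWithinAt_id J univ)
  have h2 := hasDerivWithinAt_diskPoint (χ := id) (J := fun _ => J) (s := univ) (t := χ)
    (S.hasDerivAt_radius hJ) (hasDerivWithinAt_id χ univ) (hasDerivWithinAt_const χ univ J)
  have h3 := (hh.comp_hasDerivWithinAt J h1).re'.hasDerivAt univ_mem
  have h4 := (hh.comp_hasDerivWithinAt χ h2).re'.hasDerivAt univ_mem
  constructor
  · refine h3.deriv.trans ?_
    simp [diskField]
    ring
  · rw [neg_eq_iff_eq_neg]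
    refine h4.deriv.trans ?_
    simp [diskField, diskPoint]
    ring

theorem trajectory_iff (S : IsDiskSystem h ϱ) {χ J : ℝ → ℝ} :
    IsHamiltonianTrajectory (diskHamiltonian h ϱ) χ J ↔ ∀ t, 0 ≤ t → 0 < J t ∧
      HasDerivWithinAt χ (diskField h ϱ (χ t, J t)).1 (Ici 0) t ∧
      HasDerivWithinAt J (diskField h ϱ (χ t, J t)).2 (Ici 0) t := by
  constructor
  · intro H t ht
    obtain ⟨h1, h2⟩ := S.diskField_eq (χ t) (H.pos t ht)
    exact ⟨H.pos t ht, h1 ▸ H.angle_eq t ht, h2 ▸ H.action_eq t ht⟩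
  · intro H
    refine ⟨fun t ht => (H t ht).1, fun t ht => ?_, fun t ht => ?_⟩
    · rw [(S.diskField_eq (χ t) (H t ht).1).1]; exact (H t ht).2.1
    · rw [(S.diskField_eq (χ t) (H t ht).1).2]; exact (H t ht).2.2

/-- Along a trajectory, `h` moves in the imaginary direction. -/
theorem hasDerivWithinAt_comp (S : IsDiskSystem h ϱ) {χ J : ℝ → ℝ} {s : Set ℝ} {t : ℝ}
    (hJ : 0 < J t) (h1 : HasDerivWithinAt χ (diskField h ϱ (χ t, J t)).1 s t)
    (h2 : HasDerivWithinAt J (diskField h ϱ (χ t, J t)).2 s t) :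
    HasDerivWithinAt (fun t => h (diskPoint ϱ (χ t) (J t)))
      (Complex.I * (ϱ (J t) * deriv ϱ (J t) *
        ‖diskDeriv h (diskPoint ϱ (χ t) (J t))‖ ^ 2 : ℝ)) s t := by
  have hh := S.hasDerivAt (S.diskPoint_mem_ball (χ t) hJ.le)
  refine (hh.comp_hasDerivWithinAt t
    (hasDerivWithinAt_diskPoint (S.hasDerivAt_radius hJ) h1 h2)).congr_deriv ?_
  simp only [diskField]
  set a := diskDeriv h (diskPoint ϱ (χ t) (J t))
  have hz : diskPoint ϱ (χ t) (J t) = (ϱ (J t) : ℂ) * Complex.exp (Complex.I * (χ t : ℂ)) := rfl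
  rw [hz]
  set e := Complex.exp (Complex.I * (χ t : ℂ)) with he
  -- With `u = e^{iχ} h'(z)`, the equations read `χ' = ϱ' Re u`, `J' = ϱ Im u`, so `(h(z))' = (ϱ' J'
  -- + i ϱ χ') u = i ϱ ϱ' ū u`.
  have hu : ‖a‖ ^ 2 = (e * a).re * (e * a).re + (e * a).im * (e * a).im := by
    have : ‖e * a‖ = ‖a‖ := by rw [norm_mul, he, norm_exp_I_mul, one_mul]
    rw [← this, Complex.sq_norm, Complex.normSq_apply]
  rw [hu, mul_assoc (ϱ (J t) : ℂ) e a]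
  have hcomm : ∀ w : ℂ, a * (w * e) = w * (e * a) := fun w => by ring
  rw [hcomm]
  generalize e * a = u
  apply Complex.ext
  · simp
    ring
  · simp
    ring

/-- Energy conservation, since `(h(z))'` is purely imaginary. A general convex time set is allowed
because global existence needs this on compact intervals first. -/
theorem re_eq_re (S : IsDiskSystem h ϱ) {χ J : ℝ → ℝ} {s : Set ℝ} (hs : Convex ℝ s)
    (H : ∀ t ∈ s, 0 < J t ∧ HasDerivWithinAt χ (diskField h ϱ (χ t, J t)).1 s t ∧
      HasDerivWithinAt J (diskField h ϱ (χ t, J t)).2 s t) {a b : ℝ} (ha : a ∈ s) (hb : b ∈ s) :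
    (h (diskPoint ϱ (χ b) (J b))).re = (h (diskPoint ϱ (χ a) (J a))).re := by
  have := hs.norm_image_sub_le_of_norm_hasDerivWithin_le (C := 0)
    (fun t ht => (S.hasDerivWithinAt_comp (H t ht).1 (H t ht).2.1 (H t ht).2.2).re')
    (fun t ht => by rw [Complex.I_mul_re, Complex.ofReal_im, neg_zero, norm_zero]) ha hb
  simpa [sub_eq_zero] using this

/-- A positive lower bound for the action on a level set avoiding the center. -/
theorem exists_lt_action (S : IsDiskSystem h ϱ) {c : ℝ} (hc : (h 0).re ≠ c) :
    ∃ δ, 0 < δ ∧ ∀ χ J, 0 < J → (h (diskPoint ϱ χ J)).re = c → δ < J := by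
  have hcont : ContinuousAt (fun z => (h z).re) 0 :=
    Complex.continuous_re.continuousAt.comp (S.hasDerivAt (by simp)).continuousAt
  obtain ⟨ε, hε, hε'⟩ := Metric.eventually_nhds_iff.1 (hcont.eventually_ne hc)
  have hϱ : ContinuousWithinAt ϱ (Ici 0) 0 := S.continuousOn 0 self_mem_Ici
  have : ∀ᶠ x in 𝓝[≥] (0 : ℝ), ϱ x < ε :=
    hϱ.eventually (gt_mem_nhds (by rwa [S.zero]))
  obtain ⟨δ, hδ, hδ'⟩ := mem_nhdsGE_iff_exists_Icc_subset.1 this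
  refine ⟨δ, hδ, fun χ J hJ hlev => ?_⟩
  by_contra! hcon
  refine hε' (y := diskPoint ϱ χ J) ?_ hlev
  rw [dist_zero_right, S.norm_diskPoint χ hJ.le]
  exact hδ' ⟨hJ.le, hcon⟩

/-- Rules out blow-up of the action in finite time. The angular component has no such uniform bound,
as `ϱ'` may be unbounded. -/
theorem abs_diskField_snd_le (S : IsDiskSystem h ϱ) {M : ℝ}
    (hM : ∀ z ∈ Metric.closedBall (0 : ℂ) 1, ‖diskDeriv h z‖ ≤ M) (χ : ℝ) {J : ℝ} (hJ : 0 ≤ J) :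
    |(diskField h ϱ (χ, J)).2| ≤ M := by
  have hz := S.diskPoint_mem_closedBall χ hJ
  refine (Complex.abs_im_le_norm _).trans ?_
  rw [norm_mul]
  calc _ ≤ 1 * M := mul_le_mul (by simpa using hz) (hM _ hz) (norm_nonneg _) zero_le_one
    _ = M := one_mul M

end IsDiskSystem

theorem tendsto_add_one_sub_of_tendsto {w : ℝ → ℝ} {l : ℝ} (hw : Tendsto w atTop (𝓝 l)) :
    Tendsto (fun t => w (t + 1) - w t) atTop (𝓝 0) := by
  simpa using (hw.comp (tendsto_atTop_add_const_right atTop 1 tendsto_id)).sub hw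

/-- A function on `[0, ∞)` with values in the reals whose derivative tends to `l` and which tends
to infinity has `0 ≤ l`. -/
theorem nonneg_of_tendsto_deriv_of_tendsto_atTop {J : ℝ → ℝ} {J' : ℝ → ℝ} {l : ℝ}
    (hJ : ∀ t, 0 ≤ t → HasDerivWithinAt J (J' t) (Ici 0) t) (hJ' : Tendsto J' atTop (𝓝 l))
    (htop : Tendsto J atTop atTop) : 0 ≤ l := by
  by_contra! hl
  obtain ⟨T, hT⟩ := eventually_atTop.1 (hJ'.eventually_lt_const hl)
  set R := max T 0
  have hR : 0 ≤ R := le_max_right _ _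
  have hanti : AntitoneOn J (Ici R) := by
    refine antitoneOn_of_deriv_nonpos (convex_Ici R)
      (fun t ht => ((hJ t (hR.trans ht)).mono (Ici_subset_Ici.2 hR)).continuousWithinAt) ?_ ?_
    · intro t ht
      rw [interior_Ici] at ht
      exact ((hJ t (hR.trans ht.le)).hasDerivAt
        (Ici_mem_nhds (hR.trans_lt ht))).differentiableAt.differentiableWithinAt
    · intro t ht
      rw [interior_Ici] at ht
      rw [((hJ t (hR.trans ht.le)).hasDerivAt (Ici_mem_nhds (hR.trans_lt ht))).deriv]
      exact (hT t ((le_max_left _ _).trans ht.le)).le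
  obtain ⟨t, ht, htJ⟩ := ((eventually_ge_atTop R).and (htop.eventually_gt_atTop (J R))).exists
  exact absurd (hanti self_mem_Ici ht ht) (not_le.2 htJ)

/-! ### Regular levels and the asymptotics of trajectories on them -/

namespace IsDiskSystem

variable {h : ℂ → ℂ} {ϱ : ℝ → ℝ}

/-- The values of the Hamilton function that occur at the center, at a critical point of `h`, or at
a critical point of the boundary values. -/
def exceptionalLevels (h : ℂ → ℂ) : Set ℝ :=
  {(h 0).re} ∪ ((fun z => (h z).re) '' {z ∈ Metric.ball (0 : ℂ) 1 | diskDeriv h z = 0}) ∪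
    ((fun θ : ℝ => (h (Complex.exp (Complex.I * (θ : ℂ)))).re) ''
      {θ : ℝ | (Complex.exp (Complex.I * (θ : ℂ)) *
        diskDeriv h (Complex.exp (Complex.I * (θ : ℂ)))).im = 0})

/-- This derivative is minus the limit of `J'`, so regularity of the level is what makes that limit
nonzero. The chain rule is taken relative to the closed disk, where the circle lies. -/
theorem hasDerivAt_boundary (S : IsDiskSystem h ϱ) (θ : ℝ) :
    HasDerivAt (fun θ : ℝ => (h (Complex.exp (Complex.I * (θ : ℂ)))).re)
      (-(Complex.exp (Complex.I * (θ : ℂ)) *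
        diskDeriv h (Complex.exp (Complex.I * (θ : ℂ)))).im) θ := by
  have h1 := (S.hasDerivWithinAt (exp_I_mul_mem_closedBall θ)).scomp θ
    (hasDerivAt_exp_I_mul θ).hasDerivWithinAt (s := univ) (fun x _ => exp_I_mul_mem_closedBall x)
  refine (h1.re'.hasDerivAt univ_mem).congr_deriv ?_
  simp
  ring

/-- On a bounded range of actions, the speed of `Im h` along a noncritical level is bounded
below. -/
theorem exists_speed_ge (S : IsDiskSystem h ϱ) {c δ R : ℝ} (hδ : 0 < δ)
    (hc : c ∉ exceptionalLevels h) :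
    ∃ η, 0 < η ∧ ∀ χ J, J ∈ Icc δ R → (h (diskPoint ϱ χ J)).re = c →
      η ≤ ϱ J * deriv ϱ J * ‖diskDeriv h (diskPoint ϱ χ J)‖ ^ 2 := by
  have hcont : ContinuousOn (deriv ϱ) (Ioi 0) :=
    S.smooth.continuousOn_deriv_of_isOpen isOpen_Ioi (by simp)
  have hsub : Icc δ R ⊆ Ioi 0 := fun x hx => hδ.trans_le hx.1
  rcases lt_or_ge R δ with hR | hR
  · exact ⟨1, one_pos, fun χ J hJ => absurd (hJ.1.trans hJ.2) (not_le.2 hR)⟩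
  have hκ : ∃ k, 0 < k ∧ ∀ J ∈ Icc δ R, k ≤ ϱ J * deriv ϱ J := by
    obtain ⟨x, hx, hmin⟩ := isCompact_Icc.exists_isMinOn (nonempty_Icc.2 hR)
      ((S.continuousOn.mono (fun x hx => mem_Ici.2 (le_of_lt (hsub hx)))).mul (hcont.mono hsub))
    exact ⟨_, mul_pos (S.radius_pos (hsub hx)) (S.deriv_pos x (hsub hx)), fun J hJ => hmin hJ⟩
  obtain ⟨k, hk, hk'⟩ := hκ
  have hϱR : ϱ R < 1 := (S.mapsTo (hδ.le.trans hR)).2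
  have hballs : Metric.closedBall (0 : ℂ) (ϱ R) ⊆ Metric.ball 0 1 :=
    Metric.closedBall_subset_ball hϱR
  have hrecont : ContinuousOn (fun z => (h z).re) (Metric.closedBall (0 : ℂ) (ϱ R)) :=
    fun z hz => (Complex.continuous_re.continuousAt.comp
      (S.hasDerivAt (hballs hz)).continuousAt).continuousWithinAt
  -- The part of the level in the smaller closed disk is compact, and a zero of `h'` on it would
  -- make `c` exceptional.
  set K := Metric.closedBall (0 : ℂ) (ϱ R) ∩ (fun z => (h z).re) ⁻¹' {c} with hK
  have hKc : IsCompact K := (isCompact_closedBall _ _).of_isClosed_subset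
    (hrecont.preimage_isClosed_of_isClosed Metric.isClosed_closedBall isClosed_singleton)
    inter_subset_left
  have hm : ∃ m, 0 < m ∧ ∀ z ∈ K, m ≤ ‖diskDeriv h z‖ := by
    rcases K.eq_empty_or_nonempty with he | hne
    · exact ⟨1, one_pos, by simp [he]⟩
    · obtain ⟨x, hx, hmin⟩ := hKc.exists_isMinOn hne ((S.continuousOn_diskDeriv.mono
        fun z hz => Metric.ball_subset_closedBall (hballs hz.1)).norm)
      refine ⟨_, norm_pos_iff.2 fun h0 => hc ?_, fun z hz => hmin hz⟩
      exact Or.inl (Or.inr ⟨x, ⟨hballs hx.1, h0⟩, hx.2⟩)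
  obtain ⟨m, hm, hm'⟩ := hm
  refine ⟨k * m ^ 2, by positivity, fun χ J hJ hlev => ?_⟩
  have hz : diskPoint ϱ χ J ∈ K := by
    refine ⟨?_, hlev⟩
    rw [mem_closedBall_zero_iff, S.norm_diskPoint χ (hsub hJ).le]
    exact S.strictMonoOn.monotoneOn (mem_Ici.2 (le_of_lt (hsub hJ))) (hδ.le.trans hR) hJ.2
  exact mul_le_mul (hk' J hJ) (pow_le_pow_left₀ hm.le (hm' _ hz) 2) (by positivity)
    (hk.le.trans (hk' J hJ))

section Trajectory

variable {χ J : ℝ → ℝ} {c : ℝ}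

/-- On a regular level the action tends to infinity. -/
theorem tendsto_action (S : IsDiskSystem h ϱ)
    (H : ∀ t, 0 ≤ t → 0 < J t ∧ HasDerivWithinAt χ (diskField h ϱ (χ t, J t)).1 (Ici 0) t ∧
      HasDerivWithinAt J (diskField h ϱ (χ t, J t)).2 (Ici 0) t)
    (hc : c ∉ exceptionalLevels h) (hlev : ∀ t, 0 ≤ t → (h (diskPoint ϱ (χ t) (J t))).re = c) :
    Tendsto J atTop atTop := by
  obtain ⟨M, hM, hM'⟩ := S.exists_norm_diskDeriv_le
  have h0c : (h 0).re ≠ c := fun h0 => hc (Or.inl (Or.inl h0.symm))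
  obtain ⟨δ, hδ, hδ'⟩ := S.exists_lt_action h0c
  set w : ℝ → ℝ := fun t => (h (diskPoint ϱ (χ t) (J t))).im with hw
  set v : ℝ → ℝ := fun t => ϱ (J t) * deriv ϱ (J t) * ‖diskDeriv h (diskPoint ϱ (χ t) (J t))‖ ^ 2
    with hv
  have hwd : ∀ t, 0 ≤ t → HasDerivWithinAt w (v t) (Ici 0) t := fun t ht => by
    refine (S.hasDerivWithinAt_comp (H t ht).1 (H t ht).2.1 (H t ht).2.2).im'.congr_deriv ?_
    rw [Complex.I_mul_im, Complex.ofReal_re]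
  have hwd' : ∀ t, 0 < t → HasDerivAt w (v t) t := fun t ht =>
    (hwd t ht.le).hasDerivAt (Ici_mem_nhds ht)
  have hwc : ContinuousOn w (Ici 0) := fun t ht => (hwd t ht).continuousWithinAt
  have hv0 : ∀ t, 0 ≤ t → 0 ≤ v t := fun t ht =>
    mul_nonneg (mul_nonneg (S.radius_pos (H t ht).1).le (S.deriv_pos _ (H t ht).1).le)
      (sq_nonneg _)
  have hmono : MonotoneOn w (Ici 0) := by
    refine monotoneOn_of_deriv_nonneg (convex_Ici 0) hwc ?_ ?_
    · intro t ht
      rw [interior_Ici] at ht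
      exact (hwd' t ht).differentiableAt.differentiableWithinAt
    · intro t ht
      rw [interior_Ici] at ht
      rw [(hwd' t ht).deriv]
      exact hv0 t ht.le
  obtain ⟨C, hC⟩ := (isCompact_closedBall (0 : ℂ) 1).exists_bound_of_continuousOn
    S.contDiffOn.continuousOn
  have hwlim : ∃ l, Tendsto w atTop (𝓝 l) := by
    have hm : Monotone (fun t => w (max t 0)) := fun a b hab =>
      hmono (mem_Ici.2 (le_max_right _ _)) (mem_Ici.2 (le_max_right _ _)) (max_le_max_right 0 hab)
    have hbdd : BddAbove (range fun t => w (max t 0)) := by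
      refine ⟨C, ?_⟩
      rintro _ ⟨t, rfl⟩
      exact ((le_abs_self _).trans (Complex.abs_im_le_norm _)).trans
        (hC _ (S.diskPoint_mem_closedBall _ (H _ (le_max_right _ _)).1.le))
    refine ⟨_, (tendsto_atTop_ciSup hm hbdd).congr' ?_⟩
    filter_upwards [eventually_ge_atTop 0] with t ht
    rw [max_eq_left ht]
  obtain ⟨l, hl⟩ := hwlim
  refine tendsto_atTop.2 fun R => ?_
  -- If `J t < R`, then `J ≤ R + M` during the next unit of time, so `w` gains at least `η` there;
  -- but its unit increments tend to zero.
  obtain ⟨η, hη, hη'⟩ := S.exists_speed_ge (R := R + M) hδ hc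
  filter_upwards [(tendsto_add_one_sub_of_tendsto hl).eventually_lt_const hη,
    eventually_ge_atTop 0] with t ht ht0
  by_contra! hcon
  have hJle : ∀ s ∈ Icc t (t + 1), J s ≤ R + M := by
    intro s hs
    have := (convex_Ici (0 : ℝ)).norm_image_sub_le_of_norm_hasDerivWithin_le (C := M)
      (fun r hr => (H r hr).2.2)
      (fun r hr => S.abs_diskField_snd_le hM' (χ r) (H r hr).1.le) ht0 (ht0.trans hs.1)
    rw [Real.norm_eq_abs, Real.norm_eq_abs, abs_of_nonneg (sub_nonneg.2 hs.1)] at this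
    have h1 : M * (s - t) ≤ M * 1 := by
      gcongr
      linarith [hs.2]
    linarith [le_abs_self (J s - J t)]
  have hgrow : η * ((t + 1) - t) ≤ w (t + 1) - w t := by
    refine (convex_Icc t (t + 1)).mul_sub_le_image_sub_of_le_deriv
      (hwc.mono fun s hs => ht0.trans hs.1) ?_ ?_ t ⟨le_rfl, by linarith⟩ (t + 1)
      ⟨by linarith, le_rfl⟩ (by linarith)
    · intro s hs
      rw [interior_Icc] at hs
      exact (hwd' s (ht0.trans_lt hs.1)).differentiableAt.differentiableWithinAt
    · intro s hs
      rw [interior_Icc] at hs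
      have hs0 := ht0.trans_lt hs.1
      rw [(hwd' s hs0).deriv]
      exact hη' _ _ ⟨(hδ' _ _ (H s hs0.le).1 (hlev s hs0.le)).le,
        hJle s (Ioo_subset_Icc_self hs)⟩ (hlev s hs0.le)
  linarith

/-- The asymptotics of a trajectory on a regular level. -/
theorem exists_asymptotics (S : IsDiskSystem h ϱ)
    (H : ∀ t, 0 ≤ t → 0 < J t ∧ HasDerivWithinAt χ (diskField h ϱ (χ t, J t)).1 (Ici 0) t ∧
      HasDerivWithinAt J (diskField h ϱ (χ t, J t)).2 (Ici 0) t)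
    (hc : (h (diskPoint ϱ (χ 0) (J 0))).re ∉ exceptionalLevels h) :
    ∃ θ : ℝ, Tendsto χ atTop (𝓝 θ) ∧ Tendsto J atTop atTop ∧
      Tendsto (deriv J) atTop (𝓝 (Complex.exp (Complex.I * (θ : ℂ)) *
        diskDeriv h (Complex.exp (Complex.I * (θ : ℂ)))).im) ∧
      0 < (Complex.exp (Complex.I * (θ : ℂ)) *
        diskDeriv h (Complex.exp (Complex.I * (θ : ℂ)))).im := by
  set c := (h (diskPoint ϱ (χ 0) (J 0))).re
  have hlev : ∀ t, 0 ≤ t → (h (diskPoint ϱ (χ t) (J t))).re = c := fun t ht =>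
    S.re_eq_re (convex_Ici 0) H (self_mem_Ici : (0 : ℝ) ∈ Ici 0) ht
  have hJ := S.tendsto_action H hc hlev
  have hϱ : Tendsto (fun t => ϱ (J t)) atTop (𝓝 1) := S.tendsto_one.comp hJ
  set g : ℝ → ℝ := fun θ => (h (Complex.exp (Complex.I * (θ : ℂ)))).re with hg
  have hdist : Tendsto (fun t => dist (diskPoint ϱ (χ t) (J t))
      (Complex.exp (Complex.I * (χ t : ℂ)))) atTop (𝓝 0) := by
    have h1 : ∀ t, dist (diskPoint ϱ (χ t) (J t)) (Complex.exp (Complex.I * (χ t : ℂ))) =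
        |ϱ (J t) - 1| := fun t => by
      rw [dist_eq_norm, diskPoint, ← sub_one_mul, norm_mul, norm_exp_I_mul, mul_one,
        ← Complex.ofReal_one, ← Complex.ofReal_sub, Complex.norm_real, Real.norm_eq_abs]
    simp only [h1]
    simpa using (hϱ.sub_const 1).abs
  -- Uniform continuity is needed: the points `e^{iχ}` are not yet known to converge.
  have hglim : Tendsto (fun t => g (χ t)) atTop (𝓝 c) := by
    have huc := (isCompact_closedBall (0 : ℂ) 1).uniformContinuousOn_of_continuous
      S.contDiffOn.continuousOn
    rw [Metric.tendsto_atTop']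
    intro ε hε
    obtain ⟨δ, hδ, hδ'⟩ := Metric.uniformContinuousOn_iff.1 huc ε hε
    obtain ⟨T, hT⟩ := eventually_atTop.1
      ((hdist.eventually_lt_const hδ).and (eventually_ge_atTop 0))
    refine ⟨T, fun t ht => ?_⟩
    obtain ⟨h1, h2⟩ := hT t ht.le
    have h3 := hδ' _ (S.diskPoint_mem_closedBall (χ t) (H t h2).1.le) _
      (exp_I_mul_mem_closedBall (χ t)) h1
    rw [← hlev t h2, dist_comm, Real.dist_eq]
    refine lt_of_le_of_lt ?_ h3
    rw [dist_eq_norm, hg, ← Complex.sub_re]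
    exact Complex.abs_re_le_norm _
  have hreg : ∀ θ, g θ = c → -(Complex.exp (Complex.I * (θ : ℂ)) *
      diskDeriv h (Complex.exp (Complex.I * (θ : ℂ)))).im ≠ 0 := fun θ hθ h0 =>
    hc (Or.inr ⟨θ, neg_eq_zero.1 h0, hθ⟩)
  have hper : Function.Periodic g (2 * Real.pi) := fun θ => by
    simp only [hg]
    rw [← Complex.exp_periodic (Complex.I * (θ : ℂ))]
    congr 3
    push_cast
    ring
  have hχc : ContinuousOn χ (Ici 0) := fun t ht => (H t ht).2.1.continuousWithinAt
  obtain ⟨θ, hθ⟩ := exists_tendsto_of_tendsto_regular_value Real.two_pi_pos hper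
    S.hasDerivAt_boundary hreg hχc hglim
  have hgθ : g θ = c := tendsto_nhds_unique
    ((S.hasDerivAt_boundary θ).continuousAt.tendsto.comp hθ) hglim
  have hexp : Tendsto (fun t => Complex.exp (Complex.I * (χ t : ℂ))) atTop
      (𝓝 (Complex.exp (Complex.I * (θ : ℂ)))) :=
    (hasDerivAt_exp_I_mul θ).continuousAt.tendsto.comp hθ
  have hz : Tendsto (fun t => diskPoint ϱ (χ t) (J t)) atTop
      (𝓝 (Complex.exp (Complex.I * (θ : ℂ)))) := by
    simpa [diskPoint] using hϱ.ofReal.mul hexp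
  have hzw : Tendsto (fun t => diskPoint ϱ (χ t) (J t)) atTop
      (𝓝[Metric.closedBall (0 : ℂ) 1] (Complex.exp (Complex.I * (θ : ℂ)))) := by
    refine tendsto_nhdsWithin_iff.2 ⟨hz, ?_⟩
    filter_upwards [eventually_ge_atTop 0] with t ht
    exact S.diskPoint_mem_closedBall (χ t) (H t ht).1.le
  have hfield : Tendsto (fun t => (diskField h ϱ (χ t, J t)).2) atTop
      (𝓝 (Complex.exp (Complex.I * (θ : ℂ)) *
        diskDeriv h (Complex.exp (Complex.I * (θ : ℂ)))).im) :=
    (Complex.continuous_im.tendsto _).comp (hz.mul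
      ((S.continuousOn_diskDeriv _ (exp_I_mul_mem_closedBall θ)).tendsto.comp hzw))
  refine ⟨θ, hθ, hJ, hfield.congr' ?_, ?_⟩
  · filter_upwards [eventually_gt_atTop 0] with t ht
    exact ((H t ht.le).2.2.hasDerivAt (Ici_mem_nhds ht)).deriv.symm
  · have h1 := nonneg_of_tendsto_deriv_of_tendsto_atTop (fun t ht => (H t ht).2.2) hfield hJ
    exact lt_of_le_of_ne h1 fun h0 => hreg θ hgθ (by rw [← h0, neg_zero])

end Trajectory

end IsDiskSystem

/-! ### Global existence of trajectories -/

namespace IsDiskSystem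

variable {h : ℂ → ℂ} {ϱ : ℝ → ℝ}

theorem diskDeriv_eq_deriv (S : IsDiskSystem h ϱ) {z : ℂ} (hz : z ∈ Metric.ball (0 : ℂ) 1) :
    diskDeriv h z = deriv h z := (S.hasDerivAt hz).deriv.symm

theorem contDiffOn_diskDeriv (S : IsDiskSystem h ϱ) :
    ContDiffOn ℝ 1 (diskDeriv h) (Metric.ball (0 : ℂ) 1) :=
  (((S.holomorphic.deriv Metric.isOpen_ball).contDiffOn Metric.isOpen_ball).restrict_scalars
    ℝ).congr fun _ hz => S.diskDeriv_eq_deriv hz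

theorem contDiffOn_diskPoint (S : IsDiskSystem h ϱ) :
    ContDiffOn ℝ 1 (fun p : ℝ × ℝ => diskPoint ϱ p.1 p.2) {p : ℝ × ℝ | 0 < p.2} := by
  have h1 : ContDiffOn ℝ 1 (fun p : ℝ × ℝ => ϱ p.2) {p : ℝ × ℝ | 0 < p.2} :=
    (S.smooth.of_le (by simp)).comp contDiff_snd.contDiffOn fun p hp => hp
  have h2 : ContDiff ℝ 1 (fun p : ℝ × ℝ => Complex.exp (Complex.I * (p.1 : ℂ))) :=
    (contDiff_const.mul (Complex.ofRealCLM.contDiff.comp contDiff_fst)).cexp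
  exact (Complex.ofRealCLM.contDiff.comp_contDiffOn h1).mul h2.contDiffOn

theorem contDiffOn_diskField (S : IsDiskSystem h ϱ) :
    ContDiffOn ℝ 1 (diskField h ϱ) {p : ℝ × ℝ | 0 < p.2} := by
  have h2 : ContDiff ℝ 1 (fun p : ℝ × ℝ => Complex.exp (Complex.I * (p.1 : ℂ))) :=
    (contDiff_const.mul (Complex.ofRealCLM.contDiff.comp contDiff_fst)).cexp
  have h3 : ContDiffOn ℝ 1 (fun p : ℝ × ℝ => diskDeriv h (diskPoint ϱ p.1 p.2))
      {p : ℝ × ℝ | 0 < p.2} :=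
    S.contDiffOn_diskDeriv.comp S.contDiffOn_diskPoint
      fun p hp => S.diskPoint_mem_ball p.1 (le_of_lt hp)
  have h4 : ContDiffOn ℝ 1 (deriv ϱ) (Ioi 0) := S.smooth.deriv_of_isOpen isOpen_Ioi
    (WithTop.coe_le_coe.2 (le_top : (1 + 1 : ℕ∞) ≤ ⊤))
  have h5 : ContDiffOn ℝ 1 (fun p : ℝ × ℝ => deriv ϱ p.2) {p : ℝ × ℝ | 0 < p.2} :=
    h4.comp contDiff_snd.contDiffOn fun p hp => hp
  exact (h5.mul (Complex.reCLM.contDiff.comp_contDiffOn (h2.contDiffOn.mul h3))).prodMk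
    (Complex.imCLM.contDiff.comp_contDiffOn (S.contDiffOn_diskPoint.mul h3))

theorem locallyLipschitzOn_diskField (S : IsDiskSystem h ϱ) :
    LocallyLipschitzOn {p : ℝ × ℝ | 0 < p.2} (diskField h ϱ) := by
  intro p hp
  have hopen : IsOpen {p : ℝ × ℝ | 0 < p.2} := isOpen_lt continuous_const continuous_snd
  obtain ⟨K, t, ht, hK⟩ :=
    (S.contDiffOn_diskField.contDiffAt (hopen.mem_nhds hp)).exists_lipschitzOnWith
  exact ⟨K, t, mem_nhdsWithin_of_mem_nhds ht, hK⟩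

/-- On a level set avoiding the center, trajectories exist on every compact time interval. -/
theorem exists_solution_Icc (S : IsDiskSystem h ϱ) {p : ℝ × ℝ} (hp : 0 < p.2)
    (hc : (h 0).re ≠ (h (diskPoint ϱ p.1 p.2)).re) {T : ℝ} (hT : 0 ≤ T) :
    ∃ γ : ℝ → ℝ × ℝ, γ 0 = p ∧ ∀ t ∈ Icc (0 : ℝ) T, 0 < (γ t).2 ∧
      HasDerivWithinAt γ (diskField h ϱ (γ t)) (Icc 0 T) t := by
  obtain ⟨M, hM, hM'⟩ := S.exists_norm_diskDeriv_le
  obtain ⟨δ, hδ, hδ'⟩ := S.exists_lt_action hc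
  have hδp : δ < p.2 := hδ' p.1 p.2 hp rfl
  set R := p.2 + M * T with hR
  have hδR : δ ≤ R := by
    have := mul_nonneg hM.le hT
    linarith
  set clamp : ℝ → ℝ := fun x => max δ (min R x) with hclamp
  have hclamp_mem : ∀ x, clamp x ∈ Icc δ R := fun x =>
    ⟨le_max_left _ _, max_le hδR (min_le_left _ _)⟩
  have hclamp_pos : ∀ x, 0 < clamp x := fun x => hδ.trans_le (hclamp_mem x).1
  have hclamp_eq : ∀ x ∈ Icc δ R, clamp x = x := fun x hx => by
    simp only [hclamp]
    rw [min_eq_right hx.2, max_eq_right hx.1]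
  set π : ℝ × ℝ → ℝ × ℝ := fun q => (q.1, clamp q.2) with hπ
  have hπL : LipschitzWith 1 π := by
    have h1 : LipschitzWith 1 clamp := (LipschitzWith.id.const_min R).const_max δ
    simpa using LipschitzWith.prodMk LipschitzWith.prod_fst (h1.comp LipschitzWith.prod_snd)
  have hcont : ContinuousOn (deriv ϱ) (Ioi 0) :=
    S.smooth.continuousOn_deriv_of_isOpen isOpen_Ioi (by simp)
  obtain ⟨D, hD⟩ := (isCompact_Icc (a := δ) (b := R)).exists_bound_of_continuousOn
    (hcont.mono fun x hx => hδ.trans_le hx.1)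
  have hbound : ∀ q, ‖diskField h ϱ (π q)‖ ≤ (|D| + 1) * M := by
    intro q
    have hz := S.diskPoint_mem_closedBall q.1 (hclamp_pos q.2).le
    refine max_le ?_ ?_
    · simp only [diskField, hπ, norm_mul]
      refine mul_le_mul (((hD _ (hclamp_mem q.2)).trans (le_abs_self D)).trans (by linarith)) ?_
        (norm_nonneg _) (by positivity)
      refine (Complex.abs_re_le_norm _).trans ?_
      rw [norm_mul, norm_exp_I_mul, one_mul]
      exact hM' _ hz
    · refine (S.abs_diskField_snd_le hM' q.1 (hclamp_pos q.2).le).trans ?_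
      nlinarith [abs_nonneg D]
  set L : NNReal := ⟨(|D| + 1) * M, by positivity⟩ with hL
  -- A curve of speed at most `L` stays in this ball up to time `T`.
  set a : NNReal := L * ⟨T, hT⟩ with ha
  have hlip : ∃ K, LipschitzOnWith K (fun q => diskField h ϱ (π q)) (Metric.closedBall p a) := by
    have hcomp : IsCompact (π '' Metric.closedBall p a) :=
      (isCompact_closedBall _ _).image hπL.continuous
    have hsub : π '' Metric.closedBall p a ⊆ {p : ℝ × ℝ | 0 < p.2} := by
      rintro _ ⟨q, -, rfl⟩
      exact hclamp_pos q.2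
    obtain ⟨K, hK⟩ :=
      (S.locallyLipschitzOn_diskField.mono hsub).exists_lipschitzOnWith_of_compact hcomp
    exact ⟨K * 1, hK.comp hπL.lipschitzOnWith (mapsTo_image _ _)⟩
  obtain ⟨K, hK⟩ := hlip
  have hpl : IsPicardLindelof (fun _ q => diskField h ϱ (π q)) (⟨0, le_rfl, hT⟩ : Icc 0 T) p a 0 L
      K := by
    refine IsPicardLindelof.of_time_independent (fun q _ => hbound q) hK ?_
    simp only [ha, sub_zero, sub_self, max_eq_left hT, NNReal.coe_zero]
    exact le_rfl
  obtain ⟨γ, hγ0, hγ⟩ := hpl.exists_eq_forall_mem_Icc_hasDerivWithinAt₀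
  replace hγ0 : γ 0 = p := hγ0
  have hfst : ∀ t ∈ Icc 0 T, HasDerivWithinAt (fun t => (γ t).1) (diskField h ϱ (π (γ t))).1
      (Icc 0 T) t := fun t ht =>
    (hasFDerivAt_fst (𝕜 := ℝ) (p := γ t)).comp_hasDerivWithinAt t (hγ t ht)
  have hsnd : ∀ t ∈ Icc 0 T, HasDerivWithinAt (fun t => (γ t).2) (diskField h ϱ (π (γ t))).2
      (Icc 0 T) t := fun t ht =>
    (hasFDerivAt_snd (𝕜 := ℝ) (p := γ t)).comp_hasDerivWithinAt t (hγ t ht)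
  have hupper : ∀ t ∈ Icc 0 T, (γ t).2 ≤ R := by
    intro t ht
    have h0 : (0 : ℝ) ∈ Icc 0 T := ⟨le_rfl, hT⟩
    have := (convex_Icc 0 T).norm_image_sub_le_of_norm_hasDerivWithin_le (C := M) hsnd
      (fun r _ => S.abs_diskField_snd_le hM' (γ r).1 (hclamp_pos (γ r).2).le) h0 ht
    rw [hγ0, Real.norm_eq_abs, Real.norm_eq_abs, sub_zero, abs_of_nonneg ht.1] at this
    have h1 : M * t ≤ M * T := mul_le_mul_of_nonneg_left ht.2 hM.le
    linarith [le_abs_self ((γ t).2 - p.2)]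
  have hγc : ContinuousOn (fun t => (γ t).2) (Icc 0 T) := fun t ht =>
    (hsnd t ht).continuousWithinAt
  have hlower : ∀ t ∈ Icc 0 T, δ < (γ t).2 := by
    intro t ht
    by_contra! hcon
    have hK : IsCompact (Icc 0 T ∩ (fun t => (γ t).2) ⁻¹' Iic δ) :=
      isCompact_Icc.of_isClosed_subset (hγc.preimage_isClosed_of_isClosed isClosed_Icc isClosed_Iic)
        inter_subset_left
    -- At the first time `s` with action at most `δ`, continuity gives action at least `δ`. So the
    -- clamp is inactive on `[0, s]`, energy is conserved there, and the level bound gives action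
    -- above `δ` at `s`.
    obtain ⟨s, ⟨hs, hsδ⟩, hleast⟩ := hK.exists_isLeast ⟨t, ht, hcon⟩
    have hbefore : ∀ r ∈ Icc 0 s, r ≠ s → δ < (γ r).2 := by
      intro r hr hrs
      by_contra! hr'
      exact hrs (le_antisymm hr.2 (hleast ⟨⟨hr.1, hr.2.trans hs.2⟩, hr'⟩))
    have hsge : δ ≤ (γ s).2 := by
      rcases eq_or_lt_of_le hs.1 with h0 | h0
      · rw [← h0, hγ0]; exact hδp.le
      · have h1 : Tendsto (fun t => (γ t).2) (𝓝[<] s) (𝓝 (γ s).2) :=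
          (hγc s hs).tendsto.mono_left (nhdsWithin_le_of_mem
            (mem_of_superset (Ioo_mem_nhdsLT h0) fun r hr => ⟨hr.1.le, hr.2.le.trans hs.2⟩))
        refine ge_of_tendsto h1 ?_
        filter_upwards [Ioo_mem_nhdsLT h0] with r hr
        exact (hbefore r (Ioo_subset_Icc_self hr) hr.2.ne).le
    have hon : ∀ r ∈ Icc 0 s, (γ r).2 ∈ Icc δ R := by
      intro r hr
      refine ⟨?_, hupper r ⟨hr.1, hr.2.trans hs.2⟩⟩
      by_cases hrs : r = s
      · rw [hrs]; exact hsge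
      · exact (hbefore r hr hrs).le
    have hsub : Icc 0 s ⊆ Icc 0 T := Icc_subset_Icc_right hs.2
    have hcons := S.re_eq_re (χ := fun t => (γ t).1) (J := fun t => (γ t).2) (convex_Icc 0 s)
      (fun r hr => by
        have hπr : π (γ r) = γ r := by
          simp only [hπ]; rw [hclamp_eq _ (hon r hr)]
        refine ⟨hδ.trans_le (hon r hr).1, ?_, ?_⟩
        · simpa only [hπr] using (hfst r (hsub hr)).mono hsub
        · simpa only [hπr] using (hsnd r (hsub hr)).mono hsub)
      (⟨le_rfl, hs.1⟩ : (0 : ℝ) ∈ Icc 0 s) (⟨hs.1, le_rfl⟩ : s ∈ Icc 0 s)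
    simp only [hγ0] at hcons
    exact absurd (hδ' _ _ (hδ.trans_le hsge) hcons) (not_lt.2 hsδ)
  refine ⟨γ, hγ0, fun t ht => ⟨hδ.trans (hlower t ht), ?_⟩⟩
  have hπt : π (γ t) = γ t := by
    simp only [hπ]; rw [hclamp_eq _ ⟨(hlower t ht).le, hupper t ht⟩]
  simpa only [hπt] using hγ t ht

/-- On a level set avoiding the center, trajectories exist for all nonnegative times. -/
theorem exists_trajectory (S : IsDiskSystem h ϱ) {p : ℝ × ℝ} (hp : 0 < p.2)
    (hc : (h 0).re ≠ (h (diskPoint ϱ p.1 p.2)).re) :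
    ∃ χ J : ℝ → ℝ, IsHamiltonianTrajectory (diskHamiltonian h ϱ) χ J ∧ χ 0 = p.1 ∧ J 0 = p.2 := by
  obtain ⟨γ, hγ0, hγ⟩ := exists_solution_Ici_of_forall_nat S.locallyLipschitzOn_diskField
    (fun n => S.exists_solution_Icc hp hc (Nat.cast_nonneg n))
  refine ⟨fun t => (γ t).1, fun t => (γ t).2, S.trajectory_iff.2 fun t ht => ⟨(hγ t ht).1, ?_, ?_⟩,
    congrArg Prod.fst hγ0, congrArg Prod.snd hγ0⟩
  · exact (hasFDerivAt_fst (𝕜 := ℝ) (p := γ t)).comp_hasDerivWithinAt t (hγ t ht).2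
  · exact (hasFDerivAt_snd (𝕜 := ℝ) (p := γ t)).comp_hasDerivWithinAt t (hγ t ht).2

end IsDiskSystem

/-! ### Almost every phase point lies on a regular level -/

namespace IsDiskSystem

variable {h : ℂ → ℂ} {ϱ : ℝ → ℝ}

theorem countable_critical (S : IsDiskSystem h ϱ)
    (hnonconst : ¬ ∃ c : ℂ, ∀ z ∈ Metric.ball (0 : ℂ) 1, h z = c) :
    {z ∈ Metric.ball (0 : ℂ) 1 | diskDeriv h z = 0}.Countable := by
  refine (countable_setOf_deriv_eq_zero S.holomorphic hnonconst).mono ?_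
  exact fun z hz => ⟨hz.1, (S.diskDeriv_eq_deriv hz.1).symm.trans hz.2⟩

/-- One point, a countable set, and the critical values of a differentiable function of one real
variable. -/
theorem volume_exceptionalLevels (S : IsDiskSystem h ϱ)
    (hnonconst : ¬ ∃ c : ℂ, ∀ z ∈ Metric.ball (0 : ℂ) 1, h z = c) :
    volume (exceptionalLevels h) = 0 := by
  refine measure_union_null (measure_union_null (measure_singleton _)
    (((S.countable_critical hnonconst).image _).measure_zero _)) ?_
  refine addHaar_image_eq_zero_of_det_fderivWithin_eq_zero volume
    (fun θ _ => (S.hasDerivAt_boundary θ).hasFDerivAt.hasFDerivWithinAt) fun θ hθ => ?_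
  have : (Complex.exp (Complex.I * (θ : ℂ)) *
      diskDeriv h (Complex.exp (Complex.I * (θ : ℂ)))).im = 0 := hθ
  simp [this]

/-- Polar coordinates are regular away from the center: a kernel vector `v` satisfies `ϱ' v.2 = 0`
and `ϱ v.1 = 0`, with both factors positive. -/
theorem hasStrictFDerivAt_diskPoint (S : IsDiskSystem h ϱ) {p : ℝ × ℝ} (hp : 0 < p.2) :
    ∃ A : ℝ × ℝ →L[ℝ] ℂ, HasStrictFDerivAt (fun p : ℝ × ℝ => diskPoint ϱ p.1 p.2) A p ∧
      Function.Injective A := by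
  have hopen : IsOpen {p : ℝ × ℝ | 0 < p.2} := isOpen_lt continuous_const continuous_snd
  have hstrict := (S.contDiffOn_diskPoint.contDiffAt (hopen.mem_nhds hp)).hasStrictFDerivAt
    one_ne_zero
  refine ⟨_, hstrict, (injective_iff_map_eq_zero _).2 ?_⟩
  intro v hv
  have hline : HasDerivAt (fun t : ℝ => p + t • v) v 0 := by
    simpa using ((hasDerivAt_id (0 : ℝ)).smul_const v).const_add p
  have h1 : HasDerivAt (fun t : ℝ => diskPoint ϱ (p + t • v).1 (p + t • v).2) _ 0 :=
    HasFDerivAt.comp_hasDerivAt (x := (0 : ℝ)) (f := fun t : ℝ => p + t • v)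
      (l := fun p : ℝ × ℝ => diskPoint ϱ p.1 p.2) (by simpa using hstrict.hasFDerivAt) hline
  have h2 := (hasDerivWithinAt_diskPoint (ϱ := ϱ) (s := univ) (t := 0)
    (χ := fun t => (p + t • v).1) (J := fun t => (p + t • v).2) (ϱ' := deriv ϱ p.2)
    (by simpa using S.hasDerivAt_radius hp)
    (((hasFDerivAt_fst (𝕜 := ℝ)).comp_hasDerivAt 0 hline).hasDerivWithinAt)
    (((hasFDerivAt_snd (𝕜 := ℝ)).comp_hasDerivAt 0 hline).hasDerivWithinAt)).hasDerivAt univ_mem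
  have h3 := h2.unique h1
  rw [hv, mul_eq_zero, or_iff_left (Complex.exp_ne_zero _)] at h3
  have hre := congrArg Complex.re h3
  have him := congrArg Complex.im h3
  simp [(S.deriv_pos _ hp).ne', (S.radius_pos hp).ne'] at hre him
  exact Prod.ext him hre

/-- Almost every phase point lies on a regular level. -/
theorem volume_setOf_exceptional (S : IsDiskSystem h ϱ)
    (hnonconst : ¬ ∃ c : ℂ, ∀ z ∈ Metric.ball (0 : ℂ) 1, h z = c) :
    volume {p : ℝ × ℝ | 0 < p.2 ∧ (h (diskPoint ϱ p.1 p.2)).re ∈ exceptionalLevels h} = 0 := by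
  -- `C` has countable image under the polar map. On `N` the map `h(z)` is a local diffeomorphism,
  -- with image in the null strip over the exceptional levels.
  set C : Set (ℝ × ℝ) := {p | 0 < p.2 ∧ diskDeriv h (diskPoint ϱ p.1 p.2) = 0}
  set N : Set (ℝ × ℝ) := {p | 0 < p.2 ∧ diskDeriv h (diskPoint ϱ p.1 p.2) ≠ 0 ∧
    (h (diskPoint ϱ p.1 p.2)).re ∈ exceptionalLevels h}
  let e : ℂ ≃L[ℝ] ℝ × ℝ := Complex.equivRealProdCLM
  have hC : volume C = 0 := by
    refine measure_eq_zero_of_image_of_hasStrictFDerivAt volume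
      (f := fun p : ℝ × ℝ => e (diskPoint ϱ p.1 p.2)) (fun p hp => ?_) ?_
    · obtain ⟨A, hA, hA'⟩ := S.hasStrictFDerivAt_diskPoint hp.1
      exact ⟨(e : ℂ →L[ℝ] ℝ × ℝ).comp A, e.hasStrictFDerivAt.comp p hA, e.injective.comp hA'⟩
    · refine measure_mono_null ?_ (((S.countable_critical hnonconst).image e).measure_zero _)
      rintro _ ⟨p, hp, rfl⟩
      exact ⟨_, ⟨S.diskPoint_mem_ball p.1 hp.1.le, hp.2⟩, rfl⟩
  have hN : volume N = 0 := by
    refine measure_eq_zero_of_image_of_hasStrictFDerivAt volume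
      (f := fun p : ℝ × ℝ => e (h (diskPoint ϱ p.1 p.2))) (fun p hp => ?_) ?_
    · obtain ⟨A, hA, hA'⟩ := S.hasStrictFDerivAt_diskPoint hp.1
      have hz := S.diskPoint_mem_ball p.1 hp.1.le
      have hh :=
        (S.holomorphic.analyticOnNhd Metric.isOpen_ball _ hz).hasStrictFDerivAt.restrictScalars ℝ
      have hinj : Function.Injective
          ((fderiv ℂ h (diskPoint ϱ p.1 p.2)).restrictScalars ℝ : ℂ →L[ℝ] ℂ) := by
        refine (injective_iff_map_eq_zero _).2 fun v hv => ?_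
        have h1 : v * diskDeriv h (diskPoint ϱ p.1 p.2) = 0 := by
          simpa [(S.hasDerivAt hz).hasFDerivAt.fderiv] using hv
        exact (mul_eq_zero.1 h1).resolve_right hp.2.1
      refine ⟨_, e.hasStrictFDerivAt.comp p (hh.comp p hA), ?_⟩
      exact e.injective.comp (hinj.comp hA')
    · refine measure_mono_null (t := exceptionalLevels h ×ˢ univ) ?_ ?_
      · rintro _ ⟨p, hp, rfl⟩
        exact ⟨hp.2.2, mem_univ _⟩
      · rw [Measure.volume_eq_prod, Measure.prod_prod, S.volume_exceptionalLevels hnonconst,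
          zero_mul]
  refine measure_mono_null (fun p hp => ?_) (measure_union_null hC hN)
  by_cases h0 : diskDeriv h (diskPoint ϱ p.1 p.2) = 0
  · exact Or.inl ⟨hp.1, h0⟩
  · exact Or.inr ⟨hp.1, h0, hp.2⟩

end IsDiskSystem

theorem theorem1
    (h : ℂ → ℂ)
    (hC1 : ContDiffOn ℝ 1 h (Metric.closedBall (0 : ℂ) 1))
    (hhol : DifferentiableOn ℂ h (Metric.ball (0 : ℂ) 1))
    (hnonconst : ¬ ∃ c : ℂ, ∀ z ∈ Metric.ball (0 : ℂ) 1, h z = c)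
    (ϱ : ℝ → ℝ)
    (hmaps : MapsTo ϱ (Ici 0) (Ico 0 1))
    (hcont : ContinuousOn ϱ (Ici 0))
    (hsmooth : ContDiffOn ℝ ∞ ϱ (Ioi 0))
    (hderiv : ∀ x : ℝ, 0 < x → 0 < deriv ϱ x)
    (hzero : ϱ 0 = 0)
    (hlim : Tendsto ϱ atTop (𝓝 1)) :
    ∀ᵐ p : ℝ × ℝ, 0 < p.2 →
      (∃ χ J : ℝ → ℝ, IsHamiltonianTrajectory (diskHamiltonian h ϱ) χ J ∧
        χ 0 = p.1 ∧ J 0 = p.2) ∧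
      ∀ χ J : ℝ → ℝ, IsHamiltonianTrajectory (diskHamiltonian h ϱ) χ J →
        χ 0 = p.1 → J 0 = p.2 →
        ∃ χinf : ℝ,
          Tendsto χ atTop (𝓝 χinf) ∧
          Tendsto J atTop atTop ∧
          Tendsto (deriv J) atTop
            (𝓝 (Complex.exp (Complex.I * (χinf : ℂ)) *
              derivWithin h (Metric.closedBall (0 : ℂ) 1)
                (Complex.exp (Complex.I * (χinf : ℂ)))).im) ∧
          0 < (Complex.exp (Complex.I * (χinf : ℂ)) *
              derivWithin h (Metric.closedBall (0 : ℂ) 1)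
                (Complex.exp (Complex.I * (χinf : ℂ)))).im := by
  have S : IsDiskSystem h ϱ := ⟨hC1, hhol, hmaps, hcont, hsmooth, hderiv, hzero, hlim⟩
  have hnull := measure_eq_zero_iff_ae_notMem.1 (S.volume_setOf_exceptional hnonconst)
  filter_upwards [hnull] with p hp hp2
  have hc : (h (diskPoint ϱ p.1 p.2)).re ∉ IsDiskSystem.exceptionalLevels h := fun hmem =>
    hp ⟨hp2, hmem⟩
  refine ⟨S.exists_trajectory hp2 fun h0 => hc (Or.inl (Or.inl h0.symm)), ?_⟩
  intro χ J H hχ0 hJ0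
  exact S.exists_asymptotics (S.trajectory_iff.1 H) (by rwa [hχ0, hJ0])
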